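/- Let $(M,g)$ be a connected smooth Lorentzian manifold of dimension $n+1$, and let $\mathfrak{k}$ be the Lie algebra of its Killing vector fields, i.e. the smooth vector fields $X$ on $M$ with $L_Xg=0$, under the Lie bracket of vector fields. Let $\mathcal H\subset M$ be a null hypersurface (an injectively immersed smooth submanifold of codimension one, carrying its manifold topology, such that $g|_{T_a\mathcal H}$ is degenerate for every $a\in\mathcal H$). Assume that $\mathcal H$ is a Killing horizon, i.e. there is $K\in\mathfrak k$ with $g(K,K)|_{\mathcal H}=0$ and $K_a\in T_a\mathcal H\setminus\{0\}$ for every $a\in\mathcal H$, and that $\mathcal H$ is $\mathfrak k$-invariant, i.e. $X_a\in T_a\mathcal H$ for all $X\in\mathfrak k$ and $a\in\mathcal H$. Call $K\in\mathfrak k$ a generator of $\mathcal H$ if $g(K,K)|_{\mathcal H}=0$ and $K_a\in T_a\mathcal H\setminus\{0\}$ for every $a$ in an open dense subset of $\mathcal H$, and let $\mathcal A_{\mathcal H}\subset\mathfrak k$ be the set consisting of all generators of $\mathcal H$ and the zero vector field. Then $\mathcal A_{\mathcal H}$ is an ideal of the Lie algebra $\mathfrak k$ (in particular a linear subspace and a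 Lie subalgebra). -/

import Mathlib

open Set Filter VectorField
open scoped Manifold ContDiff Topology Bundle

noncomputable section

namespace Lorentz

/-- Smooth vector fields on a smooth manifold `M` of dimension `d` (without boundary). -/
abbrev SmoothVectorField (d : ℕ) (M : Type*) [TopologicalSpace M]
    [ChartedSpace (EuclideanSpace ℝ (Fin d)) M] [IsManifold (𝓡 d) ∞ M] : Type _ :=
  ContMDiffSection (𝓡 d) (EuclideanSpace ℝ (Fin d)) ∞ (TangentSpace (𝓡 d) : M → Type _)

section

variable {d : ℕ} {M : Type*} [TopologicalSpace M]
  [ChartedSpace (EuclideanSpace ℝ (Fin d)) M] [IsManifold (𝓡 d) ∞ M]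

/-- The vector field `X` is smooth at `p`. -/
abbrev SmoothAt (X : (p : M) → TangentSpace (𝓡 d) p) (p : M) : Prop :=
  ContMDiffAt (𝓡 d) ((𝓡 d).prod 𝓘(ℝ, EuclideanSpace ℝ (Fin d))) ∞
    (fun q => (⟨q, X q⟩ : TangentBundle (𝓡 d) M)) p

/-- The vector field `X` is smooth on `U`. -/
abbrev SmoothOn (X : (p : M) → TangentSpace (𝓡 d) p) (U : Set M) : Prop :=
  ContMDiffOn (𝓡 d) ((𝓡 d).prod 𝓘(ℝ, EuclideanSpace ℝ (Fin d))) ∞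
    (fun q => (⟨q, X q⟩ : TangentBundle (𝓡 d) M)) U

theorem natCast_le_infty (k : ℕ) : (k : ℕ∞ω) ≤ ∞ := by
  exact_mod_cast (le_top : (k : ℕ∞) ≤ ⊤)

theorem isManifold_infty_add_one : IsManifold (𝓡 d) (((⊤ : ℕ∞) : ℕ∞ω) + 1) M :=
  inferInstanceAs (IsManifold (𝓡 d) ∞ M)

theorem isManifold_minSmoothness (k : ℕ) : IsManifold (𝓡 d) (minSmoothness ℝ k) M := by
  rw [minSmoothness_of_isRCLikeNormedField]
  exact IsManifold.of_le (n := ∞) (natCast_le_infty _)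

theorem contMDiffAt_mlieBracket {X Y : (p : M) → TangentSpace (𝓡 d) p} {p : M}
    (hX : SmoothAt X p) (hY : SmoothAt Y p) :
    SmoothAt (mlieBracket (𝓡 d) X Y) p := by
  have := isManifold_infty_add_one (d := d) (M := M)
  have : IsManifold (𝓡 d) (minSmoothness ℝ 2) M := isManifold_minSmoothness 2
  refine ContMDiffAt.mlieBracket_vectorField (m := ⊤) (n := ⊤) hX hY ?_
  rw [minSmoothness_of_isRCLikeNormedField]
  exact le_rfl

theorem jacobi_mlieBracket {X Y Z : (p : M) → TangentSpace (𝓡 d) p} {p : M}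
    (hX : SmoothAt X p) (hY : SmoothAt Y p) (hZ : SmoothAt Z p) :
    mlieBracket (𝓡 d) X (mlieBracket (𝓡 d) Y Z) p =
      mlieBracket (𝓡 d) (mlieBracket (𝓡 d) X Y) Z p +
        mlieBracket (𝓡 d) Y (mlieBracket (𝓡 d) X Z) p := by
  have : IsManifold (𝓡 d) (minSmoothness ℝ 3) M := isManifold_minSmoothness 3
  have h : minSmoothness ℝ 2 ≤ (∞ : ℕ∞ω) := by
    rw [minSmoothness_of_isRCLikeNormedField]
    exact natCast_le_infty 2
  exact leibniz_identity_mlieBracket_apply (hX.of_le h) (hY.of_le h) (hZ.of_le h)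

/-- The Lie bracket of smooth vector fields. -/
instance : Bracket (SmoothVectorField d M) (SmoothVectorField d M) where
  bracket X Y := ⟨mlieBracket (𝓡 d) X Y, fun p =>
    contMDiffAt_mlieBracket (X.contMDiff p) (Y.contMDiff p)⟩

theorem bracket_apply (X Y : SmoothVectorField d M) (p : M) :
    ⁅X, Y⁆ p = mlieBracket (𝓡 d) X Y p := rfl

instance : LieRing (SmoothVectorField d M) where
  add_lie X Y Z := by
    ext1 p
    exact mlieBracket_add_left X.mdifferentiableAt Y.mdifferentiableAt
  lie_add X Y Z := by
    ext1 p
    exact mlieBracket_add_right Y.mdifferentiableAt Z.mdifferentiableAt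
  lie_self X := by
    ext1 p
    exact congrFun mlieBracket_self p
  leibniz_lie X Y Z := by
    ext1 p
    exact jacobi_mlieBracket (X.contMDiff p) (Y.contMDiff p) (Z.contMDiff p)

instance : LieAlgebra ℝ (SmoothVectorField d M) where
  lie_smul c X Y := by
    ext1 p
    exact mlieBracket_const_smul_right Y.mdifferentiableAt

end

/-- A smooth Lorentzian metric, of signature `(-, +, …, +)`: a smooth symmetric `2`-tensor such
that in every tangent space some vector `v` has `g(v,v) < 0` and `g` is positive definite on the
orthogonal complement of `v`. -/
structure LorentzianMetric (d : ℕ) (M : Type*) [TopologicalSpace M]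
    [ChartedSpace (EuclideanSpace ℝ (Fin d)) M] [IsManifold (𝓡 d) ∞ M] where
  val (p : M) : TangentSpace (𝓡 d) p →L[ℝ] TangentSpace (𝓡 d) p →L[ℝ] ℝ
  contMDiff : ContMDiff (𝓡 d)
    ((𝓡 d).prod 𝓘(ℝ, EuclideanSpace ℝ (Fin d) →L[ℝ] EuclideanSpace ℝ (Fin d) →L[ℝ] ℝ)) ∞
    (fun p ↦ Bundle.TotalSpace.mk'
      (EuclideanSpace ℝ (Fin d) →L[ℝ] EuclideanSpace ℝ (Fin d) →L[ℝ] ℝ) p (val p))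
  symm (p : M) (v w : TangentSpace (𝓡 d) p) : val p v w = val p w v
  lorentzian (p : M) : ∃ v : TangentSpace (𝓡 d) p, val p v v < 0 ∧
    ∀ w : TangentSpace (𝓡 d) p, val p v w = 0 → w ≠ 0 → 0 < val p w w

section

variable {d : ℕ} {M : Type*} [TopologicalSpace M]
  [ChartedSpace (EuclideanSpace ℝ (Fin d)) M] [IsManifold (𝓡 d) ∞ M]

/-- The Lie derivative of `g` along `X`, evaluated on vector fields `Y`, `Z` at `p`:
`(L_X g)(Y, Z) = X(g(Y, Z)) - g([X, Y], Z) - g(Y, [X, Z])`. -/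
def lieDerivMetric (g : LorentzianMetric d M) (X Y Z : (p : M) → TangentSpace (𝓡 d) p)
    (p : M) : ℝ :=
  mvfderiv (𝓡 d) (fun q => g.val q (Y q) (Z q)) p (X p)
    - g.val p (mlieBracket (𝓡 d) X Y p) (Z p) - g.val p (Y p) (mlieBracket (𝓡 d) X Z p)

/-- `X` is a Killing vector field: `L_X g = 0`, tested on all smooth vector fields defined on
open subsets of `M`. -/
def IsKilling (g : LorentzianMetric d M) (X : SmoothVectorField d M) : Prop :=
  ∀ U : Set M, IsOpen U → ∀ Y Z : (p : M) → TangentSpace (𝓡 d) p,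
    SmoothOn Y U → SmoothOn Z U → ∀ p ∈ U, lieDerivMetric g X Y Z p = 0

theorem contMDiffAt_metric (g : LorentzianMetric d M) {Y Z : (p : M) → TangentSpace (𝓡 d) p}
    {p : M} (hY : SmoothAt Y p) (hZ : SmoothAt Z p) :
    ContMDiffAt (𝓡 d) 𝓘(ℝ, ℝ) ∞ (fun q => g.val q (Y q) (Z q)) p := by
  have : ContMDiffAt (𝓡 d) ((𝓡 d).prod 𝓘(ℝ)) ∞
      (fun m ↦ Bundle.TotalSpace.mk' ℝ (E := Bundle.Trivial M ℝ) m (g.val m (Y m) (Z m))) p := by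
    apply ContMDiffAt.clm_bundle_apply₂ (F₁ := EuclideanSpace ℝ (Fin d))
      (F₂ := EuclideanSpace ℝ (Fin d))
    · exact g.contMDiff.contMDiffAt
    · exact hY
    · exact hZ
  rw [Bundle.contMDiffAt_totalSpace] at this
  exact this.2

theorem mvfderiv_congr {f f' : M → ℝ} {p : M} (h : f =ᶠ[𝓝 p] f') :
    mvfderiv (𝓡 d) f p = mvfderiv (𝓡 d) f' p := by
  ext v
  have h' : (mfderiv (𝓡 d) 𝓘(ℝ, ℝ) f p v : ℝ) = mfderiv (𝓡 d) 𝓘(ℝ, ℝ) f' p v :=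
    congrArg (fun L : EuclideanSpace ℝ (Fin d) →L[ℝ] ℝ => L v) h.mfderiv_eq
  exact h'

theorem contMDiffAt_derivative {f : M → ℝ} {Y : (p : M) → TangentSpace (𝓡 d) p} {p : M}
    {U : Set M} (hU : IsOpen U) (hp : p ∈ U) (hf : ContMDiffOn (𝓡 d) 𝓘(ℝ, ℝ) ∞ f U) (hY : SmoothAt Y p) :
    ContMDiffAt (𝓡 d) 𝓘(ℝ, ℝ) ∞ (fun q => mvfderiv (𝓡 d) f q (Y q)) p := by
  have h1 := hf.contMDiffOn_tangentMapWithin (m := ∞) le_rfl hU.uniqueMDiffOn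
  have hW : ContMDiffWithinAt (𝓡 d) 𝓘(ℝ, ℝ).tangent ∞
      (fun q => tangentMapWithin (𝓡 d) 𝓘(ℝ, ℝ) f U ⟨q, Y q⟩) U p :=
    (h1 ⟨p, Y p⟩ hp).comp p hY.contMDiffWithinAt (fun q hq => hq)
  have h2 := hW.contMDiffAt (hU.mem_nhds hp)
  have h3 : ContMDiffAt (𝓡 d) 𝓘(ℝ, ℝ) ∞
      (fun q => (tangentMapWithin (𝓡 d) 𝓘(ℝ, ℝ) f U ⟨q, Y q⟩).2) p :=
    (contMDiff_snd_tangentBundle_modelSpace ℝ 𝓘(ℝ, ℝ)).contMDiffAt.comp p h2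
  refine h3.congr_of_eventuallyEq ?_
  filter_upwards [hU.mem_nhds hp] with q hq
  simp only [tangentMapWithin, mfderivWithin_of_isOpen hU hq]
  rfl

/-- `[X, Y] f = X (Y f) - Y (X f)`. -/
theorem mvfderiv_mlieBracket {f : M → ℝ} {X Y : (p : M) → TangentSpace (𝓡 d) p} {p : M}
    {U : Set M} (hU : IsOpen U) (hp : p ∈ U) (hf : ContMDiffOn (𝓡 d) 𝓘(ℝ, ℝ) ∞ f U)
    (hX : SmoothOn X U) (hY : SmoothOn Y U) :
    mvfderiv (𝓡 d) f p (mlieBracket (𝓡 d) X Y p) =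
      mvfderiv (𝓡 d) (fun q => mvfderiv (𝓡 d) f q (Y q)) p (X p)
        - mvfderiv (𝓡 d) (fun q => mvfderiv (𝓡 d) f q (X q)) p (Y p) := by
  have at' {W : (p : M) → TangentSpace (𝓡 d) p} (hW : SmoothOn W U) {q : M} (hq : q ∈ U) :
      SmoothAt W q := (hW q hq).contMDiffAt (hU.mem_nhds hq)
  have hfa {q : M} (hq : q ∈ U) : ContMDiffAt (𝓡 d) 𝓘(ℝ, ℝ) ∞ f q := (hf q hq).contMDiffAt (hU.mem_nhds hq)
  have : IsManifold (𝓡 d) 2 M := IsManifold.of_le (n := ∞) (natCast_le_infty _)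
  by_cases hz : ∃ v : TangentSpace (𝓡 d) p, v ≠ 0
  swap
  · push Not at hz
    rw [hz (mlieBracket (𝓡 d) X Y p), hz (X p), hz (Y p)]
    simp
  obtain ⟨v, hv⟩ := hz
  set Z : (q : M) → TangentSpace (𝓡 d) q := FiberBundle.extend (EuclideanSpace ℝ (Fin d)) v
  have hZp : Z p = v := by simp [Z]
  obtain ⟨s, hs, hZs⟩ := FiberBundle.exists_contMDiffOn_extend (k := ∞) (𝓡 d)
    (EuclideanSpace ℝ (Fin d)) v
  have hZ : ∀ᶠ q in 𝓝 p, SmoothAt Z q := by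
    filter_upwards [eventually_mem_nhds_iff.2 hs] with q hq
    exact hZs.contMDiffAt hq
  have key : ∀ {W : (q : M) → TangentSpace (𝓡 d) q}, SmoothOn W U →
      mlieBracket (𝓡 d) W (f • Z) =ᶠ[𝓝 p]
        (fun q => mvfderiv (𝓡 d) f q (W q)) • Z + f • mlieBracket (𝓡 d) W Z := by
    intro W hW
    filter_upwards [hZ, hU.mem_nhds hp] with q hq hqU
    exact mlieBracket_smul_right ((hfa hqU).mdifferentiableAt (by simp))
      (hq.mdifferentiableAt (by simp))
  have hfp : MDifferentiableAt (𝓡 d) 𝓘(ℝ, ℝ) f p := (hfa hp).mdifferentiableAt (by simp)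
  have hZd : MDifferentiableAt (𝓡 d) ((𝓡 d).prod 𝓘(ℝ, EuclideanSpace ℝ (Fin d)))
      (fun q => (⟨q, Z q⟩ : TangentBundle (𝓡 d) M)) p := hZ.self_of_nhds.mdifferentiableAt (by simp)
  have main : ∀ {V W : (q : M) → TangentSpace (𝓡 d) q}, SmoothOn V U →
      SmoothOn W U →
      mlieBracket (𝓡 d) V (mlieBracket (𝓡 d) W (f • Z)) p =
        (mvfderiv (𝓡 d) (fun q => mvfderiv (𝓡 d) f q (W q)) p (V p) • Z p
          + mvfderiv (𝓡 d) f p (W p) • mlieBracket (𝓡 d) V Z p)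
        + (mvfderiv (𝓡 d) f p (V p) • mlieBracket (𝓡 d) W Z p
          + f p • mlieBracket (𝓡 d) V (mlieBracket (𝓡 d) W Z) p) := by
    intro V W hV hW
    have hWf := (contMDiffAt_derivative hU hp hf (at' hW hp))
    have hWZ := contMDiffAt_mlieBracket (at' hW hp) hZ.self_of_nhds
    have e : mlieBracket (𝓡 d) V (mlieBracket (𝓡 d) W (f • Z)) p = mlieBracket (𝓡 d) V
        ((fun q => mvfderiv (𝓡 d) f q (W q)) • Z + f • mlieBracket (𝓡 d) W Z) p :=
      EventuallyEq.mlieBracket_vectorField_eq EventuallyEq.rfl (key hW)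
    rw [e,
      mlieBracket_add_right, mlieBracket_smul_right, mlieBracket_smul_right]
    · exact hfp
    · exact hWZ.mdifferentiableAt (by simp)
    · exact hWf.mdifferentiableAt (by simp)
    · exact hZd
    · exact (hWf.smul_section hZ.self_of_nhds).mdifferentiableAt (by simp)
    · exact ((hfa hp).smul_section hWZ).mdifferentiableAt (by simp)
  have hXY : SmoothAt (mlieBracket (𝓡 d) X Y) p :=
    contMDiffAt_mlieBracket (at' hX hp) (at' hY hp)
  have J1 := jacobi_mlieBracket (at' hX hp) (at' hY hp) ((hfa hp).smul_section hZ.self_of_nhds)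
  have J2 := jacobi_mlieBracket (at' hX hp) (at' hY hp) hZ.self_of_nhds
  rw [main hX hY, main hY hX, mlieBracket_smul_right hfp hZd, J2, smul_add] at J1
  have J3 : (mvfderiv (𝓡 d) f p (mlieBracket (𝓡 d) X Y p) -
      (mvfderiv (𝓡 d) (fun q => mvfderiv (𝓡 d) f q (Y q)) p (X p)
        - mvfderiv (𝓡 d) (fun q => mvfderiv (𝓡 d) f q (X q)) p (Y p))) • Z p = 0 := by
    rw [sub_smul, sub_smul, sub_eq_zero, ← sub_eq_zero]
    rw [← sub_eq_zero] at J1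
    rw [← neg_eq_zero, ← J1]
    abel
  rw [hZp] at J3
  exact sub_eq_zero.1 ((smul_eq_zero.1 J3).resolve_right hv)

theorem IsKilling.bracket {g : LorentzianMetric d M} {X X' : SmoothVectorField d M}
    (hX : IsKilling g X) (hX' : IsKilling g X') : IsKilling g ⁅X, X'⁆ := by
  intro U hU Y Z hY hZ p hp
  have at' {W : (p : M) → TangentSpace (𝓡 d) p} (hW : SmoothOn W U) {q : M} (hq : q ∈ U) :
      SmoothAt W q := (hW q hq).contMDiffAt (hU.mem_nhds hq)
  have hbr {V W : (p : M) → TangentSpace (𝓡 d) p} (hV : SmoothOn V U)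
      (hW : SmoothOn W U) : SmoothOn (mlieBracket (𝓡 d) V W) U := fun q hq =>
    (contMDiffAt_mlieBracket (at' hV hq) (at' hW hq)).contMDiffWithinAt
  have hg {V W : (p : M) → TangentSpace (𝓡 d) p} (hV : SmoothOn V U)
      (hW : SmoothOn W U) : ContMDiffOn (𝓡 d) 𝓘(ℝ, ℝ) ∞ (fun q => g.val q (V q) (W q)) U := fun q hq =>
    (contMDiffAt_metric g (at' hV hq) (at' hW hq)).contMDiffWithinAt
  have hd {V W : (p : M) → TangentSpace (𝓡 d) p} (hV : SmoothOn V U)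
      (hW : SmoothOn W U) : MDifferentiableAt (𝓡 d) 𝓘(ℝ, ℝ) (fun q => g.val q (V q) (W q)) p :=
    (contMDiffAt_metric g (at' hV hp) (at' hW hp)).mdifferentiableAt (by simp)
  have hS (T : SmoothVectorField d M) : SmoothOn (d := d) (M := M) T U :=
    T.contMDiff.contMDiffOn
  have second : ∀ {A B : SmoothVectorField d M}, IsKilling g A → IsKilling g B →
      mvfderiv (𝓡 d) (fun q => mvfderiv (𝓡 d) (fun r => g.val r (Y r) (Z r)) q (B q)) p (A p) =
        (g.val p (mlieBracket (𝓡 d) A (mlieBracket (𝓡 d) B Y) p) (Z p)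
          + g.val p (mlieBracket (𝓡 d) B Y p) (mlieBracket (𝓡 d) A Z p))
        + (g.val p (mlieBracket (𝓡 d) A Y p) (mlieBracket (𝓡 d) B Z p)
          + g.val p (Y p) (mlieBracket (𝓡 d) A (mlieBracket (𝓡 d) B Z) p)) := by
    intro A B hA hB
    have e : (fun q => mvfderiv (𝓡 d) (fun r => g.val r (Y r) (Z r)) q (B q)) =ᶠ[𝓝 p]
        (fun q => g.val q (mlieBracket (𝓡 d) B Y q) (Z q)) +
          (fun q => g.val q (Y q) (mlieBracket (𝓡 d) B Z q)) := by
      filter_upwards [hU.mem_nhds hp] with q hq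
      have := hB U hU Y Z hY hZ q hq
      simp only [lieDerivMetric] at this
      simp only [Pi.add_apply]
      linarith
    have e1 := hA U hU _ Z (hbr (hS B) hY) hZ p hp
    have e2 := hA U hU Y _ hY (hbr (hS B) hZ) p hp
    simp only [lieDerivMetric] at e1 e2
    rw [mvfderiv_congr e, mvfderiv_add (hd (hbr (hS B) hY) hZ) (hd hY (hbr (hS B) hZ)),
      _root_.add_apply]
    linarith
  have J := mvfderiv_mlieBracket hU hp (hg hY hZ) (hS X) (hS X')
  rw [second hX hX', second hX' hX,
    jacobi_mlieBracket (at' (hS X) hp) (at' (hS X') hp) (at' hY hp),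
    jacobi_mlieBracket (at' (hS X) hp) (at' (hS X') hp) (at' hZ hp)] at J
  have hXX : ⇑⁅X, X'⁆ = mlieBracket (𝓡 d) X X' := rfl
  simp only [lieDerivMetric, hXX, J, map_add, _root_.add_apply]
  ring

/-- The Lie algebra of Killing vector fields of `g`. -/
def killingAlgebra (g : LorentzianMetric d M) : LieSubalgebra ℝ (SmoothVectorField d M) where
  carrier := {X | IsKilling g X}
  add_mem' := by
    intro X X' hX hX' U hU Y Z hY hZ p hp
    have e1 := hX U hU Y Z hY hZ p hp
    have e2 := hX' U hU Y Z hY hZ p hp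
    have : IsManifold (𝓡 d) 2 M := IsManifold.of_le (n := ∞) (natCast_le_infty _)
    simp only [lieDerivMetric, ContMDiffSection.coe_add] at e1 e2 ⊢
    rw [mlieBracket_add_left X.mdifferentiableAt X'.mdifferentiableAt,
      mlieBracket_add_left X.mdifferentiableAt X'.mdifferentiableAt]
    simp only [Pi.add_apply, map_add, _root_.add_apply]
    linarith
  zero_mem' := by
    intro U hU Y Z hY hZ p hp
    simp [lieDerivMetric]
  smul_mem' := by
    intro c X hX U hU Y Z hY hZ p hp
    have e1 := hX U hU Y Z hY hZ p hp
    have : IsManifold (𝓡 d) 2 M := IsManifold.of_le (n := ∞) (natCast_le_infty _)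
    simp only [lieDerivMetric, ContMDiffSection.coe_smul] at e1 ⊢
    rw [mlieBracket_const_smul_left X.mdifferentiableAt,
      mlieBracket_const_smul_left X.mdifferentiableAt]
    simp only [Pi.smul_apply, map_smul, _root_.smul_apply, smul_eq_mul]
    linear_combination c * e1
  lie_mem' := IsKilling.bracket

end

section

variable {n : ℕ} {M : Type*} [TopologicalSpace M]
  [ChartedSpace (EuclideanSpace ℝ (Fin (n + 1))) M] [IsManifold (𝓡 (n + 1)) ∞ M]
  {S : Type*} [TopologicalSpace S] [ChartedSpace (EuclideanSpace ℝ (Fin n)) S]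

/-- `ι : S → M` exhibits the `n`-dimensional manifold `S` as an injectively immersed hypersurface
`H = ι(S)` of the `(n+1)`-dimensional manifold `M`; the topology of `H` is that of `S`. -/
structure IsHypersurface (n : ℕ) {M : Type*} [TopologicalSpace M]
    [ChartedSpace (EuclideanSpace ℝ (Fin (n + 1))) M]
    {S : Type*} [TopologicalSpace S] [ChartedSpace (EuclideanSpace ℝ (Fin n)) S]
    (ι : S → M) : Prop where
  contMDiff : ContMDiff (𝓡 n) (𝓡 (n + 1)) ∞ ι
  injective : Function.Injective ι
  immersion (a : S) : Function.Injective (mfderiv (𝓡 n) (𝓡 (n + 1)) ι a)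

/-- The tangent space of the hypersurface at `ι a`, as a subspace of the tangent space of `M`. -/
def tangentSpaceAt (n : ℕ) {M : Type*} [TopologicalSpace M]
    [ChartedSpace (EuclideanSpace ℝ (Fin (n + 1))) M]
    {S : Type*} [TopologicalSpace S] [ChartedSpace (EuclideanSpace ℝ (Fin n)) S]
    (ι : S → M) (a : S) : Submodule ℝ (TangentSpace (𝓡 (n + 1)) (ι a)) :=
  LinearMap.range (mfderiv (𝓡 n) (𝓡 (n + 1)) ι a).toLinearMap

/-- A null hypersurface: the metric restricted to each of its tangent spaces is degenerate. -/
structure IsNullHypersurface (g : LorentzianMetric (n + 1) M) (ι : S → M) : Prop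
    extends IsHypersurface n ι where
  degenerate (a : S) : ∃ v ∈ tangentSpaceAt n ι a, v ≠ 0 ∧
    ∀ w ∈ tangentSpaceAt n ι a, g.val (ι a) v w = 0

/-- A Killing horizon: a null hypersurface with a Killing vector field that is null, nonzero and
tangent to it at each of its points. -/
structure IsKillingHorizon (g : LorentzianMetric (n + 1) M) (ι : S → M) : Prop
    extends IsNullHypersurface g ι where
  exists_killing : ∃ K ∈ killingAlgebra g, ∀ a : S,
    g.val (ι a) (K (ι a)) (K (ι a)) = 0 ∧ K (ι a) ∈ tangentSpaceAt n ι a ∧ K (ι a) ≠ 0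

/-- Every Killing vector field is tangent to the hypersurface. -/
def IsKillingInvariant (g : LorentzianMetric (n + 1) M) (ι : S → M) : Prop :=
  ∀ X ∈ killingAlgebra g, ∀ a : S, X (ι a) ∈ tangentSpaceAt n ι a

/-- Generators of the horizon: Killing vector fields that are null on it, and tangent to it and
nonzero at all points of an open dense subset of it. -/
def IsGenerator (g : LorentzianMetric (n + 1) M) (ι : S → M) (K : killingAlgebra g) : Prop :=
  (∀ a : S, g.val (ι a) (K.1 (ι a)) (K.1 (ι a)) = 0) ∧
    ∃ U : Set S, IsOpen U ∧ Dense U ∧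
      ∀ a ∈ U, K.1 (ι a) ∈ tangentSpaceAt n ι a ∧ K.1 (ι a) ≠ 0

/-- The set of all generators of the horizon, together with the zero vector field. -/
def generators (g : LorentzianMetric (n + 1) M) (ι : S → M) : Set (killingAlgebra g) :=
  {K | IsGenerator g ι K} ∪ {0}

end

end Lorentz

end

/-! At a point of a null hypersurface the tangent space is degenerate, and Lorentzian signature
forces its null vectors to lie on one line, the radical. A Killing field tangent to the hypersurface
is therefore null there exactly when it is orthogonal to the tangent space
(`IsNullHypersurface.orthogonal_of_null`), so the quadratic condition `g(K,K) = 0` becomes linear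
and its solutions form a subspace.

For the ideal property, let `L` be null on the hypersurface, `X` Killing and `Y = [X, L]`. By
invariance `X`, `Y` and `[X, Y]` are tangent, so `g(L,Y)` vanishes along the hypersurface, and so
does its derivative along `X`. The Killing equation then reads `g(Y,Y) = -g(L,[X,Y])`, and the right
side vanishes too (`bracket_null`). This gives `nullIdeal`.

It remains to identify this ideal with the generators and zero (`mem_generators_iff`): a nonzero
Killing field cannot vanish on an open piece of a hypersurface. At a point of such a piece its
derivative in a chart is skew for the metric and kills a hyperplane, hence is zero
(`eq_zero_of_skew_of_comp_eq_zero`). The differentiated Killing equation bounds the second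
derivative by the first-order jet, so a field with zero jet at a point vanishes nearby
(`IsKilling.eventually_eq_zero`), and connectedness spreads this over the manifold
(`IsKilling.eq_zero`). -/

namespace Lorentz

/-! ### Unique continuation for the Killing equation in a vector space, and skew maps. -/

section Euclidean

set_option maxSynthPendingDepth 3

variable {E F : Type*} [NormedAddCommGroup E] [NormedSpace ℝ E]
  [NormedAddCommGroup F] [NormedSpace ℝ F]

/-- An injective continuous linear map on a finite-dimensional space is bounded below, uniformly
for all nearby maps. -/
theorem eventually_norm_le_of_injective [FiniteDimensional ℝ E] {B : E → E →L[ℝ] F} {x₀ : E}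
    (hB : ContinuousAt B x₀) (hinj : ∀ v, B x₀ v = 0 → v = 0) :
    ∃ c : ℝ, 0 < c ∧ ∀ᶠ x in 𝓝 x₀, ∀ v, ‖v‖ ≤ c * ‖B x v‖ := by
  obtain ⟨K, hK, hanti⟩ := LinearMap.exists_antilipschitzWith (B x₀).toLinearMap
    (LinearMap.ker_eq_bot'.2 hinj)
  have hK' : (0 : ℝ) < K := hK
  -- A perturbation of norm below `1 / (2 * K)` costs at most half of `‖v‖`, which is absorbed on
  -- the left at the price of doubling `K`.
  refine ⟨2 * K, by positivity, ?_⟩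
  have hnear : ∀ᶠ x in 𝓝 x₀, dist (B x) (B x₀) < 1 / (2 * K) :=
    Metric.tendsto_nhds.1 hB _ (by positivity)
  filter_upwards [hnear] with x hx v
  have h1 : ‖v‖ ≤ K * ‖B x₀ v‖ := by
    simpa using hanti.le_mul_dist v 0
  have h2 : ‖B x₀ v‖ ≤ ‖B x v‖ + 1 / (2 * K) * ‖v‖ := by
    have h3 : B x₀ v = B x v - (B x - B x₀) v := by simp
    rw [h3]
    refine (norm_sub_le _ _).trans (add_le_add_right ?_ _)
    refine ((B x - B x₀).le_opNorm v).trans ?_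
    rw [dist_eq_norm] at hx
    gcongr
  have h4 : K * (1 / (2 * K) * ‖v‖) = ‖v‖ / 2 := by field_simp
  have h5 := mul_le_mul_of_nonneg_left h2 hK'.le
  rw [mul_add, h4] at h5
  linarith

/-- The right-hand side of the Killing equation differentiated once. -/
noncomputable def prolongedKillingTerm (G : E → E →L[ℝ] E →L[ℝ] ℝ) (X : E → E) (x u v w : E) : ℝ :=
  -(fderiv ℝ (fderiv ℝ G) x u (X x) v w + fderiv ℝ G x (fderiv ℝ X x u) v w
    + fderiv ℝ G x u (fderiv ℝ X x v) w + fderiv ℝ G x u v (fderiv ℝ X x w))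

theorem abs_apply_le₃ (T : E →L[ℝ] E →L[ℝ] E →L[ℝ] ℝ) {C a b c : ℝ} {u v w : E}
    (hT : ‖T‖ ≤ C) (hu : ‖u‖ ≤ a) (hv : ‖v‖ ≤ b) (hw : ‖w‖ ≤ c) :
    |T u v w| ≤ C * a * b * c := by
  have h1 : ‖T u‖ ≤ C * a := T.le_of_opNorm_le_of_le hT hu
  have h2 : ‖T u v‖ ≤ C * a * b := (T u).le_of_opNorm_le_of_le h1 hv
  exact (T u v).le_of_opNorm_le_of_le h2 hw

/-- One of the four terms contains `X` and three contain its derivative, whence the factor 3. -/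
theorem abs_prolongedKillingTerm_le {G : E → E →L[ℝ] E →L[ℝ] ℝ} {X : E → E} {x : E} {C : ℝ}
    (h1 : ‖fderiv ℝ G x‖ ≤ C) (h2 : ‖fderiv ℝ (fderiv ℝ G) x‖ ≤ C) (u v w : E) :
    |prolongedKillingTerm G X x u v w| ≤
      C * (‖X x‖ + 3 * ‖fderiv ℝ X x‖) * ‖u‖ * ‖v‖ * ‖w‖ := by
  have e1 := abs_apply_le₃ (fderiv ℝ (fderiv ℝ G) x u) (u := X x) (v := v) (w := w)
    ((fderiv ℝ (fderiv ℝ G) x).le_of_opNorm_le h2 u) le_rfl le_rfl le_rfl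
  have e2 := abs_apply_le₃ (fderiv ℝ G x) (v := v) (w := w) h1
    ((fderiv ℝ X x).le_opNorm u) le_rfl le_rfl
  have e3 := abs_apply_le₃ (fderiv ℝ G x) (u := u) (w := w) h1 le_rfl
    ((fderiv ℝ X x).le_opNorm v) le_rfl
  have e4 := abs_apply_le₃ (fderiv ℝ G x) (u := u) (v := v) h1 le_rfl le_rfl
    ((fderiv ℝ X x).le_opNorm w)
  rw [prolongedKillingTerm, abs_neg]
  refine (abs_add_le _ _).trans ((add_le_add ((abs_add_le _ _).trans
    (add_le_add ((abs_add_le _ _).trans (add_le_add e1 e2)) e3)) e4).trans (le_of_eq ?_))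
  ring

/-- The Killing equation differentiated once. -/
theorem prolonged_killing {U : Set E} (hU : IsOpen U) {G : E → E →L[ℝ] E →L[ℝ] ℝ} {X : E → E}
    (hG : ContDiffOn ℝ 2 G U) (hX : ContDiffOn ℝ 2 X U)
    (hK : ∀ x ∈ U, ∀ v w, fderiv ℝ G x (X x) v w + G x (fderiv ℝ X x v) w
      + G x v (fderiv ℝ X x w) = 0) {x : E} (hx : x ∈ U) (u v w : E) :
    G x (fderiv ℝ (fderiv ℝ X) x u v) w + G x v (fderiv ℝ (fderiv ℝ X) x u w)
      = prolongedKillingTerm G X x u v w := by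
  have hGx := hG.contDiffAt (hU.mem_nhds hx)
  have hXx := hX.contDiffAt (hU.mem_nhds hx)
  have dG := (hGx.differentiableAt two_ne_zero).hasFDerivAt
  have dX := (hXx.differentiableAt two_ne_zero).hasFDerivAt
  have ddG := ((hGx.fderiv_right (m := 1) le_rfl).differentiableAt one_ne_zero).hasFDerivAt
  have ddX := ((hXx.fderiv_right (m := 1) le_rfl).differentiableAt one_ne_zero).hasFDerivAt
  have dXc (v : E) := ddX.clm_apply (hasFDerivAt_const v x)
  have d1 := ((ddG.clm_apply dX).clm_apply (hasFDerivAt_const v x)).clm_apply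
    (hasFDerivAt_const w x)
  have d2 := (dG.clm_apply (dXc v)).clm_apply (hasFDerivAt_const w x)
  have d3 := (dG.clm_apply (hasFDerivAt_const v x)).clm_apply (dXc w)
  have d := (d1.add d2).add d3
  have hz : HasFDerivAt (fun _ : E => (0 : ℝ)) (0 : E →L[ℝ] ℝ) x := hasFDerivAt_const 0 x
  have hz' := hz.congr_of_eventuallyEq (f₁ := fun y => fderiv ℝ G y (X y) v w
      + G y (fderiv ℝ X y v) w + G y v (fderiv ℝ X y w)) (by
    filter_upwards [hU.mem_nhds hx] with y hy using hK y hy v w)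
  have := congrArg (fun L : E →L[ℝ] ℝ => L u) (d.unique hz')
  simp at this
  rw [prolongedKillingTerm]
  linarith

/-- This is the Christoffel-symbol trick: `(u, v) ↦ D²X u v` is symmetric, so an alternating sum of
the prolonged equation over cyclic choices of arguments isolates `G (D²X u v) w`. Uniform
nondegeneracy of `G` then recovers `D²X` itself. -/
theorem norm_sndFDeriv_le_of_killing {U : Set E} (hU : IsOpen U)
    {G : E → E →L[ℝ] E →L[ℝ] ℝ} {X : E → E}
    (hG : ContDiffOn ℝ 2 G U) (hX : ContDiffOn ℝ 2 X U)
    (hsymm : ∀ x ∈ U, ∀ v w, G x v w = G x w v)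
    (hK : ∀ x ∈ U, ∀ v w, fderiv ℝ G x (X x) v w + G x (fderiv ℝ X x v) w
      + G x v (fderiv ℝ X x w) = 0) {x : E} (hx : x ∈ U) {c C : ℝ} (hc : 0 ≤ c)
    (hbelow : ∀ v, ‖v‖ ≤ c * ‖G x v‖)
    (h1 : ‖fderiv ℝ G x‖ ≤ C) (h2 : ‖fderiv ℝ (fderiv ℝ G) x‖ ≤ C) :
    ‖fderiv ℝ (fderiv ℝ X) x‖ ≤ c * (2 * (C * (‖X x‖ + 3 * ‖fderiv ℝ X x‖))) := by
  have hC : 0 ≤ C := (norm_nonneg _).trans h1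
  have hXx := hX.contDiffAt (hU.mem_nhds hx)
  have hs : ∀ u v, fderiv ℝ (fderiv ℝ X) x u v = fderiv ℝ (fderiv ℝ X) x v u :=
    fun u v => (hXx.isSymmSndFDerivAt (by simp)).eq u v
  set A := C * (‖X x‖ + 3 * ‖fderiv ℝ X x‖) with hA
  have hA0 : 0 ≤ A := by positivity
  refine ContinuousLinearMap.opNorm_le_bound _ (by positivity) fun u => ?_
  refine ContinuousLinearMap.opNorm_le_bound _ (by positivity) fun v => ?_
  have key : ‖G x (fderiv ℝ (fderiv ℝ X) x u v)‖ ≤ 2 * A * ‖u‖ * ‖v‖ := by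
    refine ContinuousLinearMap.opNorm_le_bound _ (by positivity) fun w => ?_
    have p1 := prolonged_killing hU hG hX hK hx u v w
    have p2 := prolonged_killing hU hG hX hK hx v u w
    have p3 := prolonged_killing hU hG hX hK hx w u v
    have b1 := abs_le.1 (abs_prolongedKillingTerm_le (X := X) h1 h2 u v w)
    have b2 := abs_le.1 (abs_prolongedKillingTerm_le (X := X) h1 h2 v u w)
    have b3 := abs_le.1 (abs_prolongedKillingTerm_le (X := X) h1 h2 w u v)
    rw [← hA] at b1 b2 b3
    have r2 : A * ‖v‖ * ‖u‖ * ‖w‖ = A * ‖u‖ * ‖v‖ * ‖w‖ := by ring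
    have r3 : A * ‖w‖ * ‖u‖ * ‖v‖ = A * ‖u‖ * ‖v‖ * ‖w‖ := by ring
    rw [r2] at b2
    rw [r3] at b3
    -- The identities combine as `p1 + p2 - p3`, which equals twice the wanted quantity; this gives
    -- the bound `3 / 2 * A`, and `q0` covers the slack up to `2 * A`.
    have q0 : 0 ≤ A * ‖u‖ * ‖v‖ * ‖w‖ := by positivity
    rw [hs v u, hsymm x hx u] at p2
    rw [hs w u, hs w v, hsymm x hx u] at p3
    rw [hsymm x hx v] at p1
    rw [Real.norm_eq_abs, abs_le]
    constructor <;> linarith [b1.1, b1.2, b2.1, b2.2, b3.1, b3.2]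
  calc ‖fderiv ℝ (fderiv ℝ X) x u v‖ ≤ c * ‖G x (fderiv ℝ (fderiv ℝ X) x u v)‖ := hbelow _
    _ ≤ c * (2 * A * ‖u‖ * ‖v‖) := by gcongr
    _ = c * (2 * A) * ‖u‖ * ‖v‖ := by ring

/-- A field whose second derivative is bounded by its first-order jet, and whose jet vanishes at the
centre of a ball, vanishes on the ball. -/
theorem eq_zero_of_norm_sndFDeriv_le {X : E → F} {x₀ : E} {r K : ℝ}
    (hX : ContDiffOn ℝ 2 X (Metric.ball x₀ r))
    (hK : ∀ x ∈ Metric.ball x₀ r,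
      ‖fderiv ℝ (fderiv ℝ X) x‖ ≤ K * ‖(X x, fderiv ℝ X x)‖)
    (h0 : X x₀ = 0) (h1 : fderiv ℝ X x₀ = 0) {x : E} (hx : x ∈ Metric.ball x₀ r) : X x = 0 := by
  set γ : ℝ → E := fun t => x₀ + t • (x - x₀)
  have hr : 0 < r := Metric.pos_of_mem_ball hx
  have hγ : ∀ t ∈ Icc (0 : ℝ) 1, γ t ∈ Metric.ball x₀ r := fun t ht =>
    (convex_ball x₀ r).add_smul_sub_mem (Metric.mem_ball_self hr) hx ht
  have dγ (t : ℝ) : HasDerivAt γ (x - x₀) t := by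
    have := ((hasDerivAt_id t).smul_const (x - x₀)).const_add x₀
    rwa [one_smul] at this
  have dJ (t : ℝ) (ht : t ∈ Icc (0 : ℝ) 1) :
      HasDerivAt (fun s => (X (γ s), fderiv ℝ X (γ s)))
        (fderiv ℝ X (γ t) (x - x₀), fderiv ℝ (fderiv ℝ X) (γ t) (x - x₀)) t := by
    have hXt := hX.contDiffAt (Metric.isOpen_ball.mem_nhds (hγ t ht))
    exact ((hXt.differentiableAt two_ne_zero).hasFDerivAt.comp_hasDerivAt t (dγ t)).prodMk
      (((hXt.fderiv_right (m := 1) le_rfl).differentiableAt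
        one_ne_zero).hasFDerivAt.comp_hasDerivAt t (dγ t))
  -- Grönwall's inequality for the jet along the segment from `x₀` to `x`. The norm on pairs is the
  -- maximum: the constant 1 serves the derivative of `X`, and `K` that of `DX`.
  have := eq_zero_of_abs_deriv_le_mul_abs_self_of_eq_zero_right (K := max 1 K * ‖x - x₀‖)
    (fun t ht => (dJ t ht).continuousAt.continuousWithinAt)
    (fun t ht => (dJ t (Ico_subset_Icc_self ht)).hasDerivWithinAt) (by simp [γ, h0, h1])
    (fun t ht => ?_) 1 (by simp)
  · simpa [γ] using congrArg Prod.fst this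
  · have hJ := hK _ (hγ t (Ico_subset_Icc_self ht))
    set J := (X (γ t), fderiv ℝ X (γ t)) with hJdef
    have n1 : ‖fderiv ℝ X (γ t)‖ ≤ ‖J‖ := norm_snd_le J
    refine max_le ?_ ?_
    · calc ‖fderiv ℝ X (γ t) (x - x₀)‖ ≤ ‖J‖ * ‖x - x₀‖ :=
            ContinuousLinearMap.le_of_opNorm_le _ n1 _
        _ = 1 * ‖x - x₀‖ * ‖J‖ := by ring
        _ ≤ max 1 K * ‖x - x₀‖ * ‖J‖ := by gcongr; exact le_max_left _ _
    · calc ‖fderiv ℝ (fderiv ℝ X) (γ t) (x - x₀)‖ ≤ K * ‖J‖ * ‖x - x₀‖ :=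
            ContinuousLinearMap.le_of_opNorm_le _ hJ _
        _ = K * ‖x - x₀‖ * ‖J‖ := by ring
        _ ≤ max 1 K * ‖x - x₀‖ * ‖J‖ := by gcongr; exact le_max_right _ _

set_option synthInstance.maxHeartbeats 60000 in
/-- A solution of the Killing equation with vanishing first-order jet at a point vanishes near that
point. -/
theorem eventually_eq_zero_of_killing [FiniteDimensional ℝ E] {U : Set E} (hU : IsOpen U)
    {G : E → E →L[ℝ] E →L[ℝ] ℝ} {X : E → E}
    (hG : ContDiffOn ℝ 2 G U) (hX : ContDiffOn ℝ 2 X U)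
    (hsymm : ∀ x ∈ U, ∀ v w, G x v w = G x w v)
    (hK : ∀ x ∈ U, ∀ v w, fderiv ℝ G x (X x) v w + G x (fderiv ℝ X x v) w
      + G x v (fderiv ℝ X x w) = 0) {x₀ : E} (hx₀ : x₀ ∈ U)
    (hnd : ∀ v, (∀ w, G x₀ v w = 0) → v = 0)
    (h0 : X x₀ = 0) (h1 : fderiv ℝ X x₀ = 0) : ∀ᶠ x in 𝓝 x₀, X x = 0 := by
  have hGx := hG.contDiffAt (hU.mem_nhds hx₀)
  have c1 := hGx.fderiv_right (m := 1) le_rfl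
  have c2 := c1.fderiv_right (m := 0) (by simp)
  obtain ⟨c, hc, hbelow⟩ := eventually_norm_le_of_injective hGx.continuousAt
    (fun v hv => hnd v fun w => by simp [hv])
  obtain ⟨C, hC1, hC2⟩ : ∃ C : ℝ, ‖fderiv ℝ G x₀‖ < C ∧ ‖fderiv ℝ (fderiv ℝ G) x₀‖ < C :=
    ⟨max ‖fderiv ℝ G x₀‖ ‖fderiv ℝ (fderiv ℝ G) x₀‖ + 1,
      (le_max_left _ _).trans_lt (lt_add_one _), (le_max_right _ _).trans_lt (lt_add_one _)⟩
  have e1 := c1.continuousAt.norm.eventually_lt continuousAt_const hC1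
  have e2 := c2.continuousAt.norm.eventually_lt continuousAt_const hC2
  obtain ⟨r, hr, hball⟩ := Metric.eventually_nhds_iff_ball.1
    (((hU.eventually_mem hx₀).and hbelow).and (e1.and e2))
  refine Metric.eventually_nhds_iff_ball.2 ⟨r, hr, fun x hx => ?_⟩
  -- The 4 is 1 + 3, since `‖X‖` and `‖DX‖` are each at most the norm of the jet.
  refine eq_zero_of_norm_sndFDeriv_le (K := c * (2 * (C * 4)))
    (hX.mono fun y hy => (hball y hy).1.1) (fun y hy => ?_) h0 h1 hx
  obtain ⟨⟨yU, yb⟩, y1, y2⟩ := hball y hy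
  have hC : 0 ≤ C := (norm_nonneg _).trans y1.le
  refine (norm_sndFDeriv_le_of_killing hU hG hX hsymm hK yU hc.le yb y1.le y2.le).trans ?_
  have m1 := norm_fst_le (X y, fderiv ℝ X y)
  have m2 := norm_snd_le (X y, fderiv ℝ X y)
  have m3 : ‖X y‖ + 3 * ‖fderiv ℝ X y‖ ≤ 4 * ‖(X y, fderiv ℝ X y)‖ := by
    simp only at m1 m2
    linarith
  calc c * (2 * (C * (‖X y‖ + 3 * ‖fderiv ℝ X y‖)))
      ≤ c * (2 * (C * (4 * ‖(X y, fderiv ℝ X y)‖))) := by gcongr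
    _ = c * (2 * (C * 4)) * ‖(X y, fderiv ℝ X y)‖ := by ring

/-- A map that is skew for a nondegenerate symmetric form and vanishes on a hyperplane is zero. -/
theorem eq_zero_of_skew_of_comp_eq_zero {n : ℕ}
    {G : EuclideanSpace ℝ (Fin (n + 1)) →L[ℝ] EuclideanSpace ℝ (Fin (n + 1)) →L[ℝ] ℝ}
    {A : EuclideanSpace ℝ (Fin (n + 1)) →L[ℝ] EuclideanSpace ℝ (Fin (n + 1))}
    {B : EuclideanSpace ℝ (Fin n) →L[ℝ] EuclideanSpace ℝ (Fin (n + 1))}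
    (hsymm : ∀ v w, G v w = G w v) (hnd : ∀ v, (∀ w, G v w = 0) → v = 0)
    (hA : ∀ v w, G (A v) w + G v (A w) = 0) (hB : Function.Injective B)
    (hAB : ∀ v, A (B v) = 0) : A = 0 := by
  ext1 z
  refine hnd _ fun w => ?_
  -- By skewness the range of `A` is orthogonal to the hyperplane that `A` kills; by symmetry `A v`
  -- is also orthogonal to `v`.
  have hW : ∀ v b, G (A v) (B b) = 0 := fun v b => by
    have := hA v (B b)
    rwa [hAB, map_zero, add_zero] at this
  have hz : ∀ v, G (A v) v = 0 := fun v => by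
    have := hA v v
    rw [hsymm v] at this
    linarith
  by_cases hzB : z ∈ LinearMap.range B.toLinearMap
  · obtain ⟨b, rfl⟩ := hzB
    simp [hAB]
  -- The range of `B` has codimension one, so together with any `z` outside it spans; `A z` is
  -- orthogonal to both pieces.
  have htop : LinearMap.range B.toLinearMap ⊔ Submodule.span ℝ {z} = ⊤ := by
    apply Submodule.eq_top_of_finrank_eq
    have hlt : LinearMap.range B.toLinearMap
        < LinearMap.range B.toLinearMap ⊔ Submodule.span ℝ {z} :=
      left_lt_sup.2 fun h => hzB (h (Submodule.mem_span_singleton_self z))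
    have h1 := Submodule.finrank_lt_finrank_of_lt hlt
    rw [LinearMap.finrank_range_of_inj hB] at h1
    have h2 := Submodule.finrank_le (LinearMap.range B.toLinearMap ⊔ Submodule.span ℝ {z})
    simp only [finrank_euclideanSpace_fin] at h1 h2 ⊢
    omega
  obtain ⟨_, ⟨b, rfl⟩, _, hy, rfl⟩ := Submodule.mem_sup.1 (htop ▸ Submodule.mem_top : w ∈ _)
  obtain ⟨c, rfl⟩ := Submodule.mem_span_singleton.1 hy
  have := hW z b
  simp only [ContinuousLinearMap.coe_coe, map_add, map_smul, hz, smul_zero, add_zero]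
  exact this

end Euclidean

/-! ### Killing fields read in charts, and their unique continuation on the manifold. -/

section Chart

variable {d : ℕ} {M : Type*} [TopologicalSpace M]
  [ChartedSpace (EuclideanSpace ℝ (Fin d)) M] [IsManifold (𝓡 d) ∞ M]

set_option linter.unusedSectionVars false

/-- The derivative of the inverse of the chart at `p`. -/
noncomputable def chartInvDeriv (p : M) (x : EuclideanSpace ℝ (Fin d)) :
    EuclideanSpace ℝ (Fin d) →L[ℝ] TangentSpace (𝓡 d) ((extChartAt (𝓡 d) p).symm x) :=
  mfderiv 𝓘(ℝ, EuclideanSpace ℝ (Fin d)) (𝓡 d) (extChartAt (𝓡 d) p).symm x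

/-- The vector field `X` in the chart at `p`. -/
noncomputable def chartField (p : M) (X : (q : M) → TangentSpace (𝓡 d) q)
    (x : EuclideanSpace ℝ (Fin d)) : EuclideanSpace ℝ (Fin d) :=
  mpullback 𝓘(ℝ, EuclideanSpace ℝ (Fin d)) (𝓡 d) (extChartAt (𝓡 d) p).symm X x

/-- The vector field that is constant, equal to `v`, in the chart at `p`. -/
noncomputable def coordField (p : M) (v : EuclideanSpace ℝ (Fin d)) :
    (q : M) → TangentSpace (𝓡 d) q :=
  mpullback (𝓡 d) 𝓘(ℝ, EuclideanSpace ℝ (Fin d)) (extChartAt (𝓡 d) p) (fun _ => v)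

/-- The metric `g` in the chart at `p`. -/
noncomputable def chartMetric (g : LorentzianMetric d M) (p : M)
    (x : EuclideanSpace ℝ (Fin d)) :
    EuclideanSpace ℝ (Fin d) →L[ℝ] EuclideanSpace ℝ (Fin d) →L[ℝ] ℝ :=
  let G : EuclideanSpace ℝ (Fin d) →L[ℝ] EuclideanSpace ℝ (Fin d) →L[ℝ] ℝ :=
    g.val ((extChartAt (𝓡 d) p).symm x)
  let D : EuclideanSpace ℝ (Fin d) →L[ℝ] EuclideanSpace ℝ (Fin d) := chartInvDeriv p x
  G.bilinearComp D D

theorem chartMetric_apply (g : LorentzianMetric d M) (p : M) (x v w : EuclideanSpace ℝ (Fin d)) :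
    chartMetric g p x v w =
      g.val ((extChartAt (𝓡 d) p).symm x) (chartInvDeriv p x v) (chartInvDeriv p x w) := rfl

theorem chartInvDeriv_eq_mfderivWithin (p : M) (x : EuclideanSpace ℝ (Fin d)) :
    chartInvDeriv p x = mfderivWithin 𝓘(ℝ, EuclideanSpace ℝ (Fin d)) (𝓡 d)
      (extChartAt (𝓡 d) p).symm (range (𝓡 d)) x := by
  rw [chartInvDeriv, modelWithCornersSelf_coe, range_id, mfderivWithin_univ]

theorem isManifold_one : IsManifold (𝓡 d) 1 M := IsManifold.of_le (n := ∞) (natCast_le_infty 1)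

theorem chartInvDeriv_isInvertible {p : M} {x : EuclideanSpace ℝ (Fin d)}
    (hx : x ∈ (extChartAt (𝓡 d) p).target) : (chartInvDeriv p x).IsInvertible := by
  have := isManifold_one (d := d) (M := M)
  rw [chartInvDeriv_eq_mfderivWithin]
  exact isInvertible_mfderivWithin_extChartAt_symm hx

theorem chartInvDeriv_chartField {p : M} {X : (q : M) → TangentSpace (𝓡 d) q}
    {x : EuclideanSpace ℝ (Fin d)} (hx : x ∈ (extChartAt (𝓡 d) p).target) :
    chartInvDeriv p x (chartField p X x) = X ((extChartAt (𝓡 d) p).symm x) :=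
  (chartInvDeriv_isInvertible hx).self_apply_inverse _

theorem chartField_eq_zero_iff {p : M} {X : (q : M) → TangentSpace (𝓡 d) q}
    {x : EuclideanSpace ℝ (Fin d)} (hx : x ∈ (extChartAt (𝓡 d) p).target) :
    chartField p X x = 0 ↔ X ((extChartAt (𝓡 d) p).symm x) = 0 := by
  rw [← chartInvDeriv_chartField (X := X) hx]
  exact ((chartInvDeriv_isInvertible hx).injective.eq_iff' (map_zero _)).symm

theorem coordField_symm {p : M} {x : EuclideanSpace ℝ (Fin d)}
    (hx : x ∈ (extChartAt (𝓡 d) p).target) (v : EuclideanSpace ℝ (Fin d)) :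
    coordField p v ((extChartAt (𝓡 d) p).symm x) = chartInvDeriv p x v := by
  have := isManifold_one (d := d) (M := M)
  have hs := (extChartAt (𝓡 d) p).map_target hx
  have h := mfderiv_extChartAt_comp_mfderivWithin_extChartAt_symm (I := 𝓡 d) hx
  rw [← chartInvDeriv_eq_mfderivWithin] at h
  refine ((isInvertible_mfderiv_extChartAt hs).inverse_apply_eq).2 ?_
  exact (congrArg (fun L : EuclideanSpace ℝ (Fin d) →L[ℝ] EuclideanSpace ℝ (Fin d) => L v) h).symm

theorem chartField_coordField {p : M} {x : EuclideanSpace ℝ (Fin d)}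
    (hx : x ∈ (extChartAt (𝓡 d) p).target) (v : EuclideanSpace ℝ (Fin d)) :
    chartField p (coordField p v) x = v := by
  apply (chartInvDeriv_isInvertible hx).injective
  rw [chartInvDeriv_chartField hx, coordField_symm hx]

theorem contMDiffAt_chart_symm {p : M} {x : EuclideanSpace ℝ (Fin d)}
    (hx : x ∈ (extChartAt (𝓡 d) p).target) :
    ContMDiffAt 𝓘(ℝ, EuclideanSpace ℝ (Fin d)) (𝓡 d) ∞ (extChartAt (𝓡 d) p).symm x :=
  (contMDiffOn_extChartAt_symm p).contMDiffAt ((isOpen_extChartAt_target p).mem_nhds hx)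

theorem contDiffAt_chartField {p : M} {X : (q : M) → TangentSpace (𝓡 d) q}
    {x : EuclideanSpace ℝ (Fin d)} (hx : x ∈ (extChartAt (𝓡 d) p).target)
    (hX : SmoothAt X ((extChartAt (𝓡 d) p).symm x)) :
    ContDiffAt ℝ ∞ (chartField p X) x := by
  have := isManifold_one (d := d) (M := M)
  exact contMDiffAt_vectorSpace_iff_contDiffAt.1
    (ContMDiffAt.mpullback_vectorField_preimage (n := ∞) hX (contMDiffAt_chart_symm hx)
      (chartInvDeriv_isInvertible hx) le_rfl)

theorem smoothAt_coordField {p q : M} (hq : q ∈ (extChartAt (𝓡 d) p).source)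
    (v : EuclideanSpace ℝ (Fin d)) : SmoothAt (coordField p v) q := by
  have := isManifold_one (d := d) (M := M)
  refine ContMDiffAt.mpullback_vectorField_preimage (n := ∞)
    (contMDiffAt_vectorSpace_iff_contDiffAt.2 contDiffAt_const)
    (contMDiffAt_extChartAt' (by rwa [extChartAt_source] at hq))
    (isInvertible_mfderiv_extChartAt hq) le_rfl

theorem smoothOn_coordField (p : M) (v : EuclideanSpace ℝ (Fin d)) :
    SmoothOn (coordField p v) (extChartAt (𝓡 d) p).source :=
  fun _ hq => (smoothAt_coordField hq v).contMDiffWithinAt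

/-- In finite dimension it suffices to test on fixed vectors, where the function is the metric of
two coordinate fields composed with the inverse chart. -/
theorem contDiffOn_chartMetric (g : LorentzianMetric d M) (p : M) :
    ContDiffOn ℝ ∞ (chartMetric g p) (extChartAt (𝓡 d) p).target := by
  refine contDiffOn_clm_apply.2 fun v => contDiffOn_clm_apply.2 fun w x hx => ?_
  have hs := (extChartAt (𝓡 d) p).map_target hx
  have h := (contMDiffAt_metric g (smoothAt_coordField hs v) (smoothAt_coordField hs w)).comp x
    (contMDiffAt_chart_symm hx)
  refine (contMDiffAt_iff_contDiffAt.1 h).contDiffWithinAt.congr_of_mem (fun y hy => ?_) hx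
  simp only [Function.comp_apply, chartMetric_apply, coordField_symm hy]

/-- The bracket is natural under pullback by the inverse chart, and a coordinate field becomes
constant there, so only the derivative of `X` survives. -/
theorem mlieBracket_coordField {p : M} {X : (q : M) → TangentSpace (𝓡 d) q}
    {x : EuclideanSpace ℝ (Fin d)} (hx : x ∈ (extChartAt (𝓡 d) p).target)
    (hX : SmoothAt X ((extChartAt (𝓡 d) p).symm x)) (v : EuclideanSpace ℝ (Fin d)) :
    mlieBracket (𝓡 d) X (coordField p v) ((extChartAt (𝓡 d) p).symm x) =
      chartInvDeriv p x (-(fderiv ℝ (chartField p X) x v)) := by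
  have : IsManifold (𝓡 d) (minSmoothness ℝ 3) M := isManifold_minSmoothness 3
  have hs := (extChartAt (𝓡 d) p).map_target hx
  have h := mpullback_mlieBracket (n := ∞) (hX.mdifferentiableAt (by simp))
    ((smoothAt_coordField hs v).mdifferentiableAt (by simp)) (contMDiffAt_chart_symm hx) (by
      rw [minSmoothness_of_isRCLikeNormedField]
      exact natCast_le_infty 2)
  rw [← chartInvDeriv_chartField (X := mlieBracket (𝓡 d) X (coordField p v)) hx]
  congr 1
  refine h.trans ?_
  have hc : chartField p (coordField p v) =ᶠ[𝓝 x] fun _ => v := by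
    filter_upwards [(isOpen_extChartAt_target p).mem_nhds hx] with y hy
      using chartField_coordField hy v
  rw [← mlieBracketWithin_univ, mlieBracketWithin_eq_lieBracketWithin]
  change lieBracketWithin ℝ (chartField p X) (chartField p (coordField p v)) univ x = _
  rw [lieBracketWithin_univ, lieBracket, hc.fderiv_eq, hc.self_of_nhds]
  simp

theorem mvfderiv_eq_fderiv_comp_symm {p : M} {f : M → ℝ} {x : EuclideanSpace ℝ (Fin d)}
    (hx : x ∈ (extChartAt (𝓡 d) p).target)
    (hf : MDifferentiableAt (𝓡 d) 𝓘(ℝ, ℝ) f ((extChartAt (𝓡 d) p).symm x))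
    (v : EuclideanSpace ℝ (Fin d)) :
    mvfderiv (𝓡 d) f ((extChartAt (𝓡 d) p).symm x) (chartInvDeriv p x v) =
      fderiv ℝ (f ∘ (extChartAt (𝓡 d) p).symm) x v := by
  have h := mfderiv_comp x hf ((contMDiffAt_chart_symm hx).mdifferentiableAt (by simp))
  rw [← mfderiv_eq_fderiv, h]
  rfl

/-- Obtained by testing `L_X g = 0` on coordinate fields, which are smooth only on the chart domain;
the two bracket terms change sign by `mlieBracket_coordField`. -/
theorem chart_killing {g : LorentzianMetric d M} {X : SmoothVectorField d M}
    (hX : IsKilling g X) {p : M} {x : EuclideanSpace ℝ (Fin d)}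
    (hx : x ∈ (extChartAt (𝓡 d) p).target) (v w : EuclideanSpace ℝ (Fin d)) :
    fderiv ℝ (chartMetric g p) x (chartField p X x) v w
      + chartMetric g p x (fderiv ℝ (chartField p X) x v) w
      + chartMetric g p x v (fderiv ℝ (chartField p X) x w) = 0 := by
  have hs := (extChartAt (𝓡 d) p).map_target hx
  have h := hX _ (isOpen_extChartAt_source p) _ _ (smoothOn_coordField p v)
    (smoothOn_coordField p w) _ hs
  have hd : MDifferentiableAt (𝓡 d) 𝓘(ℝ, ℝ)
      (fun q => g.val q (coordField p v q) (coordField p w q)) ((extChartAt (𝓡 d) p).symm x) :=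
    (contMDiffAt_metric g (smoothAt_coordField hs v)
      (smoothAt_coordField hs w)).mdifferentiableAt (by simp)
  have hG : DifferentiableAt ℝ (chartMetric g p) x :=
    ((contDiffOn_chartMetric g p).contDiffAt
      ((isOpen_extChartAt_target p).mem_nhds hx)).differentiableAt (by simp)
  have e : (fun q => g.val q (coordField p v q) (coordField p w q)) ∘ (extChartAt (𝓡 d) p).symm
      =ᶠ[𝓝 x] fun y => chartMetric g p y v w := by
    filter_upwards [(isOpen_extChartAt_target p).mem_nhds hx] with y hy
    simp only [Function.comp_apply, chartMetric_apply, coordField_symm hy]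
  have hfd : fderiv ℝ (fun y => chartMetric g p y v w) x (chartField p X x) =
      fderiv ℝ (chartMetric g p) x (chartField p X x) v w := by
    have := (hG.hasFDerivAt.clm_apply (hasFDerivAt_const v x)).clm_apply (hasFDerivAt_const w x)
    rw [this.fderiv]
    simp
  rw [lieDerivMetric, mlieBracket_coordField hx (X.contMDiff _),
    mlieBracket_coordField hx (X.contMDiff _), coordField_symm hx, coordField_symm hx,
    ← chartInvDeriv_chartField (X := X) hx, mvfderiv_eq_fderiv_comp_symm hx hd, e.fderiv_eq,
    hfd] at h
  simp only [map_neg, _root_.neg_apply, ← chartMetric_apply] at h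
  linarith

/-- A nonzero vector orthogonal to everything would lie in the positive definite complement of a
timelike `t`, yet be null. -/
theorem LorentzianMetric.nondegenerate (g : LorentzianMetric d M) {p : M}
    {v : TangentSpace (𝓡 d) p} (hv : ∀ w, g.val p v w = 0) : v = 0 := by
  obtain ⟨t, -, ht⟩ := g.lorentzian p
  by_contra h
  exact (ht v (by rw [g.symm, hv]) h).ne' (hv v)

theorem chartMetric_symm (g : LorentzianMetric d M) (p : M) (x v w : EuclideanSpace ℝ (Fin d)) :
    chartMetric g p x v w = chartMetric g p x w v := g.symm _ _ _

theorem chartMetric_nondegenerate (g : LorentzianMetric d M) {p : M}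
    {x : EuclideanSpace ℝ (Fin d)} (hx : x ∈ (extChartAt (𝓡 d) p).target)
    {v : EuclideanSpace ℝ (Fin d)} (hv : ∀ w, chartMetric g p x v w = 0) : v = 0 := by
  apply (chartInvDeriv_isInvertible hx).injective
  rw [map_zero]
  refine g.nondegenerate fun w => ?_
  obtain ⟨w, rfl⟩ := (chartInvDeriv_isInvertible hx).surjective w
  exact hv w

/-- A Killing vector field whose first-order jet vanishes at `p` vanishes near `p`. -/
theorem IsKilling.eventually_eq_zero {g : LorentzianMetric d M} {X : SmoothVectorField d M}
    (hX : IsKilling g X) {p : M} (h0 : X p = 0)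
    (h1 : fderiv ℝ (chartField p X) (extChartAt (𝓡 d) p p) = 0) : ∀ᶠ q in 𝓝 p, X q = 0 := by
  have hp := mem_extChartAt_target (I := 𝓡 d) p
  have h := eventually_eq_zero_of_killing (isOpen_extChartAt_target p)
    ((contDiffOn_chartMetric g p).of_le (natCast_le_infty 2))
    (fun x hx => ((contDiffAt_chartField (X := X) hx (X.contMDiff _)).of_le
      (natCast_le_infty 2)).contDiffWithinAt)
    (fun x _ => chartMetric_symm g p x) (fun x hx => chart_killing hX hx) hp
    (fun v => chartMetric_nondegenerate g hp)
    ((chartField_eq_zero_iff hp).2 (by rwa [extChartAt_to_inv])) h1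
  filter_upwards [(continuousAt_extChartAt p).eventually h, extChartAt_source_mem_nhds (I := 𝓡 d) p]
    with q hq hqs
  have := (chartField_eq_zero_iff ((extChartAt (𝓡 d) p).map_source hqs)).1 hq
  rwa [(extChartAt (𝓡 d) p).left_inv hqs] at this

/-- A Killing vector field on a connected manifold that vanishes on a nonempty open set is zero. -/
theorem IsKilling.eq_zero [ConnectedSpace M] {g : LorentzianMetric d M}
    {X : SmoothVectorField d M} (hX : IsKilling g X) {p : M} (hp : ∀ᶠ q in 𝓝 p, X q = 0) :
    X = 0 := by
  -- The set of points near which `X` vanishes is open by definition. At a limit point of it the jet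
  -- of `X` vanishes by continuity, and a zero jet forces `X` to vanish nearby.
  have hclosed : IsClosed {q : M | ∀ᶠ r in 𝓝 q, X r = 0} := by
    refine isClosed_iff_frequently.2 fun q hq => ?_
    have hqt := mem_extChartAt_target (I := 𝓡 d) q
    have hsm := contDiffAt_chartField (X := X) hqt (X.contMDiff _)
    have hfr : ∃ᶠ x in 𝓝 (extChartAt (𝓡 d) q q),
        chartField q X x = 0 ∧ fderiv ℝ (chartField q X) x = 0 := by
      refine (continuousAt_extChartAt q).frequently ?_
      refine (hq.and_eventually (extChartAt_source_mem_nhds (I := 𝓡 d) q)).mono ?_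
      rintro r ⟨hr, hrs⟩
      have hrt := (extChartAt (𝓡 d) q).map_source hrs
      have hev : chartField q X =ᶠ[𝓝 (extChartAt (𝓡 d) q r)] fun _ => 0 := by
        have hc := (contMDiffAt_chart_symm hrt).continuousAt
        rw [ContinuousAt, (extChartAt (𝓡 d) q).left_inv hrs] at hc
        filter_upwards [hc.eventually hr, (isOpen_extChartAt_target q).mem_nhds hrt]
          with x hx hxt using (chartField_eq_zero_iff hxt).2 hx
      exact ⟨hev.self_of_nhds, by rw [hev.fderiv_eq]; simp⟩
    have hlim {F : Type} [NormedAddCommGroup F] {f : EuclideanSpace ℝ (Fin d) → F}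
        (hf : ContinuousAt f (extChartAt (𝓡 d) q q))
        (h : ∃ᶠ x in 𝓝 (extChartAt (𝓡 d) q q), f x = 0) : f (extChartAt (𝓡 d) q q) = 0 := by
      by_contra hne
      exact h (hf.eventually_ne hne)
    have h0 := hlim hsm.continuousAt (hfr.mono fun _ h => h.1)
    have h1 := hlim (hsm.fderiv_right (m := 0) (by simp)).continuousAt (hfr.mono fun _ h => h.2)
    refine hX.eventually_eq_zero ?_ h1
    have := (chartField_eq_zero_iff hqt).1 h0
    rwa [extChartAt_to_inv] at this
  have huniv := IsClopen.eq_univ ⟨hclosed, isOpen_setOfPred_eventually_nhds⟩ ⟨p, hp⟩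
  ext1 q
  exact (huniv ▸ mem_univ q : q ∈ {q : M | ∀ᶠ r in 𝓝 q, X r = 0}).self_of_nhds

end Chart

/-! ### Killing fields along null hypersurfaces, and the ideal of null ones. -/

section Horizon

set_option maxSynthPendingDepth 3
set_option linter.unusedSectionVars false

variable {n : ℕ} {M : Type*} [TopologicalSpace M]
  [ChartedSpace (EuclideanSpace ℝ (Fin (n + 1))) M] [IsManifold (𝓡 (n + 1)) ∞ M]
  {S : Type*} [TopologicalSpace S] [ChartedSpace (EuclideanSpace ℝ (Fin n)) S]
  {g : LorentzianMetric (n + 1) M} {ι : S → M}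

/-- A Killing vector field that vanishes on a nonempty open part of a hypersurface is zero. -/
theorem IsKilling.eq_zero_of_eventually_hypersurface [ConnectedSpace M]
    {X : SmoothVectorField (n + 1) M} (hX : IsKilling g X) (hι : IsHypersurface n ι) {a : S}
    (ha : ∀ᶠ b in 𝓝 a, X (ι b) = 0) : X = 0 := by
  have := isManifold_one (d := n + 1) (M := M)
  refine hX.eq_zero (hX.eventually_eq_zero ha.self_of_nhds ?_)
  set φ := extChartAt (𝓡 (n + 1)) (ι a)
  have ht : φ (ι a) ∈ φ.target := mem_extChartAt_target (I := 𝓡 (n + 1)) (ι a)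
  have hι' : MDifferentiableAt (𝓡 n) (𝓡 (n + 1)) ι a :=
    hι.contMDiff.contMDiffAt.mdifferentiableAt (by simp)
  have hφ' : MDifferentiableAt (𝓡 (n + 1)) 𝓘(ℝ, EuclideanSpace ℝ (Fin (n + 1))) φ (ι a) :=
    mdifferentiableAt_extChartAt (mem_chart_source _ _)
  have hψ := hφ'.hasMFDerivAt.comp a hι'.hasMFDerivAt
  have hinv := isInvertible_mfderiv_extChartAt (mem_extChartAt_source (I := 𝓡 (n + 1)) (ι a))
  -- `B` is the derivative of the immersion seen in the chart; as `X` vanishes along the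
  -- hypersurface near `a`, the chain rule gives `DX ∘ B = 0`.
  set B : EuclideanSpace ℝ (Fin n) →L[ℝ] EuclideanSpace ℝ (Fin (n + 1)) :=
    (mfderiv (𝓡 (n + 1)) 𝓘(ℝ, EuclideanSpace ℝ (Fin (n + 1))) φ (ι a)).comp
      (mfderiv (𝓡 n) (𝓡 (n + 1)) ι a)
  have hBinj : Function.Injective B := hinv.injective.comp (hι.immersion a)
  have hd : DifferentiableAt ℝ (chartField (ι a) X) (φ (ι a)) :=
    (contDiffAt_chartField (X := X) ht (X.contMDiff _)).differentiableAt (by simp)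
  have hcomp : HasMFDerivAt (𝓡 n) 𝓘(ℝ, EuclideanSpace ℝ (Fin (n + 1)))
      (chartField (ι a) X ∘ (φ ∘ ι)) a
      ((fderiv ℝ (chartField (ι a) X) (φ (ι a))).comp B) :=
    hd.hasFDerivAt.hasMFDerivAt.comp a hψ
  have hzero : chartField (ι a) X ∘ (φ ∘ ι) =ᶠ[𝓝 a] fun _ => 0 := by
    filter_upwards [ha, hι'.continuousAt (extChartAt_source_mem_nhds (I := 𝓡 (n + 1)) (ι a))]
      with b hb hbs
    refine (chartField_eq_zero_iff (φ.map_source hbs)).2 ?_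
    change X (φ.symm (φ (ι b))) = 0
    rwa [φ.left_inv hbs]
  have hAB := hasMFDerivAt_unique hcomp
    ((hasMFDerivAt_const (0 : EuclideanSpace ℝ (Fin (n + 1))) a).congr_of_eventuallyEq hzero)
  have hX0 : chartField (ι a) X (φ (ι a)) = 0 := hzero.self_of_nhds
  refine eq_zero_of_skew_of_comp_eq_zero (chartMetric_symm g (ι a) (φ (ι a)))
    (fun v => chartMetric_nondegenerate g ht) (fun v w => ?_) hBinj (fun v => ?_)
  -- Where `X` vanishes, the term differentiating the metric drops out, and what is left says that
  -- `DX` is skew.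
  · have := chart_killing hX ht v w
    rw [hX0, ContinuousLinearMap.map_zero] at this
    simpa using this
  · exact congrArg
      (fun L : EuclideanSpace ℝ (Fin n) →L[ℝ] EuclideanSpace ℝ (Fin (n + 1)) => L v) hAB

/-- On a null hypersurface, a null tangent vector is orthogonal to the tangent space. -/
theorem IsNullHypersurface.orthogonal_of_null (hι : IsNullHypersurface g ι) {a : S}
    {u w : TangentSpace (𝓡 (n + 1)) (ι a)} (hu : u ∈ tangentSpaceAt n ι a)
    (h0 : g.val (ι a) u u = 0) (hw : w ∈ tangentSpaceAt n ι a) : g.val (ι a) u w = 0 := by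
  obtain ⟨v, hv, hv0, hrad⟩ := hι.degenerate a
  obtain ⟨t, -, ht⟩ := g.lorentzian (ι a)
  have htv : g.val (ι a) t v ≠ 0 := fun h => (ht v h hv0).ne' (hrad v hv)
  -- With this `c` the null vector `u - c • v` is orthogonal to the timelike `t`, where the metric
  -- is positive definite; hence it is zero, and `u` is a multiple of the radical vector `v`.
  set c := g.val (ι a) t u / g.val (ι a) t v with hc
  have huv : u - c • v = 0 := by
    by_contra hne
    refine (ht (u - c • v) ?_ hne).ne' ?_
    · simp [hc, htv]
    · simp [h0, hrad v hv, hrad u hu, g.symm (ι a) u v]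
  rw [sub_eq_zero.1 huv]
  simp [hrad w hw]

/-- The values of `X` lie in varying fibres, so continuity is applied to its chart representative,
which has the same zeros. -/
theorem isOpen_setOf_comp_ne_zero (X : SmoothVectorField (n + 1) M)
    (hι : Continuous ι) : IsOpen {a : S | X (ι a) ≠ 0} := by
  refine isOpen_iff_mem_nhds.2 fun a ha => ?_
  have hs := extChartAt_source_mem_nhds (I := 𝓡 (n + 1)) (ι a)
  have ht := mem_extChartAt_target (I := 𝓡 (n + 1)) (ι a)
  have hne : chartField (ι a) X (extChartAt (𝓡 (n + 1)) (ι a) (ι a)) ≠ 0 := fun h => ha (by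
    have := (chartField_eq_zero_iff ht).1 h
    rwa [extChartAt_to_inv] at this)
  have hc : ContinuousAt (fun q => chartField (ι a) X (extChartAt (𝓡 (n + 1)) (ι a) q)) (ι a) :=
    ContinuousAt.comp (contDiffAt_chartField (X := X) ht (X.contMDiff _)).continuousAt
      (continuousAt_extChartAt (ι a))
  filter_upwards [hι.continuousAt hs, hι.continuousAt.eventually (hc.eventually_ne hne)]
    with b hbs hb hzero
  refine hb ((chartField_eq_zero_iff ((extChartAt (𝓡 (n + 1)) (ι a)).map_source hbs)).2 ?_)
  rwa [(extChartAt (𝓡 (n + 1)) (ι a)).left_inv hbs]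

/-- For an invariant hypersurface, the generators together with zero are exactly the Killing vector
fields that are null on it. -/
theorem mem_generators_iff [ConnectedSpace M] (hι : IsHypersurface n ι)
    (hinv : IsKillingInvariant g ι) {K : killingAlgebra g} :
    K ∈ generators g ι ↔ ∀ a : S, g.val (ι a) (K.1 (ι a)) (K.1 (ι a)) = 0 := by
  constructor
  · rintro (h | h)
    · exact h.1
    · intro a
      rw [mem_singleton_iff.1 h]
      simp
  · intro h
    by_cases hK : K = 0
    · exact Or.inr hK
    refine Or.inl ⟨h, {a | K.1 (ι a) ≠ 0},
      isOpen_setOf_comp_ne_zero K.1 hι.contMDiff.continuous, ?_,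
      fun a ha => ⟨hinv K.1 K.2 a, ha⟩⟩
    -- If the nonvanishing set missed a neighbourhood of `a`, then `K` would vanish on an open piece
    -- of the hypersurface and hence everywhere.
    refine fun a => mem_closure_iff_frequently.2 fun hev => hK (Subtype.ext ?_)
    exact IsKilling.eq_zero_of_eventually_hypersurface K.2 hι
      (hev.mono fun b hb => not_not.1 hb)

/-- The derivative of a function vanishing on a hypersurface is zero in tangent directions. -/
theorem mvfderiv_eq_zero_of_comp_eq_zero (hι : IsHypersurface n ι) {f : M → ℝ} {a : S}
    (hf : MDifferentiableAt (𝓡 (n + 1)) 𝓘(ℝ, ℝ) f (ι a)) (h0 : ∀ b, f (ι b) = 0)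
    {v : TangentSpace (𝓡 (n + 1)) (ι a)} (hv : v ∈ tangentSpaceAt n ι a) :
    mvfderiv (𝓡 (n + 1)) f (ι a) v = 0 := by
  obtain ⟨u, rfl⟩ := hv
  have h := hf.hasMFDerivAt.comp a
    (hι.contMDiff.contMDiffAt.mdifferentiableAt (by simp) :
      MDifferentiableAt (𝓡 n) _ ι a).hasMFDerivAt
  have hz : f ∘ ι = fun _ => 0 := funext h0
  rw [hz] at h
  exact congrArg (fun L : EuclideanSpace ℝ (Fin n) →L[ℝ] ℝ => L u)
    (hasMFDerivAt_unique h (hasMFDerivAt_const (0 : ℝ) a))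

/-- The bracket of a Killing vector field with one that is null on an invariant null hypersurface is
null on it: apply `L_X g = 0` to `g(L, [X, L])`, where `[X, L]` and `[X, [X, L]]` are tangent. -/
theorem bracket_null (hι : IsNullHypersurface g ι) (hinv : IsKillingInvariant g ι)
    (X L : killingAlgebra g) (hL : ∀ a : S, g.val (ι a) (L.1 (ι a)) (L.1 (ι a)) = 0) (a : S) :
    g.val (ι a) ((⁅X, L⁆ : killingAlgebra g).1 (ι a)) ((⁅X, L⁆ : killingAlgebra g).1 (ι a)) = 0 := by
  set Y : killingAlgebra g := ⁅X, L⁆ with hY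
  have horth (Z : killingAlgebra g) (b : S) : g.val (ι b) (L.1 (ι b)) (Z.1 (ι b)) = 0 :=
    hι.orthogonal_of_null (hinv _ L.2 b) (hL b) (hinv _ Z.2 b)
  have hX : IsKilling g X.1 := X.2
  have h := hX univ isOpen_univ L.1 Y.1 L.1.contMDiff.contMDiffOn Y.1.contMDiff.contMDiffOn
    (ι a) (mem_univ _)
  -- The function `g(L, Y)` vanishes only along the hypersurface, but `X` is tangent to it, so the
  -- derivative along `X` is zero.
  rw [lieDerivMetric, mvfderiv_eq_zero_of_comp_eq_zero hι.toIsHypersurface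
    ((contMDiffAt_metric g (L.1.contMDiff _) (Y.1.contMDiff _)).mdifferentiableAt (by simp))
    (horth Y) (hinv _ X.2 a)] at h
  have h1 : mlieBracket (𝓡 (n + 1)) X.1 L.1 (ι a) = Y.1 (ι a) := rfl
  have h2 : mlieBracket (𝓡 (n + 1)) X.1 Y.1 (ι a) = (⁅X, Y⁆ : killingAlgebra g).1 (ι a) := rfl
  rw [h1, h2, horth] at h
  linarith

/-- The ideal of Killing vector fields that are null on an invariant null hypersurface. -/
def nullIdeal (hι : IsNullHypersurface g ι) (hinv : IsKillingInvariant g ι) :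
    LieIdeal ℝ (killingAlgebra g) where
  carrier := {K | ∀ a : S, g.val (ι a) (K.1 (ι a)) (K.1 (ι a)) = 0}
  add_mem' := by
    intro K L hK hL a
    -- Orthogonality to the whole tangent space removes the cross terms of `g(K + L, K + L)`.
    have h1 := hι.orthogonal_of_null (hinv _ K.2 a) (hK a) (hinv _ L.2 a)
    have h2 := hι.orthogonal_of_null (hinv _ L.2 a) (hL a) (hinv _ K.2 a)
    have h3 : (K + L).1 (ι a) = K.1 (ι a) + L.1 (ι a) := rfl
    rw [h3]
    simp [hK a, hL a, h1, h2]
  zero_mem' := by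
    intro a
    simp
  smul_mem' := by
    intro c K hK a
    have h : (c • K).1 (ι a) = c • K.1 (ι a) := rfl
    rw [h]
    simp [hK a]
  lie_mem := fun {X L} hL a => bracket_null hι hinv X L hL a

end Horizon

end Lorentz

open Lorentz in
theorem mainTheorem5 {n : ℕ} {M : Type*} [TopologicalSpace M]
    [ChartedSpace (EuclideanSpace ℝ (Fin (n + 1))) M] [IsManifold (𝓡 (n + 1)) ∞ M]
    [T2Space M] [SecondCountableTopology M] [ConnectedSpace M]
    (g : LorentzianMetric (n + 1) M)
    {S : Type*} [TopologicalSpace S] [ChartedSpace (EuclideanSpace ℝ (Fin n)) S]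
    [IsManifold (𝓡 n) ∞ S] [T2Space S] [SecondCountableTopology S]
    (ι : S → M) (hH : IsKillingHorizon g ι) (hinv : IsKillingInvariant g ι) :
    ∃ 𝔞 : LieIdeal ℝ (killingAlgebra g), (𝔞 : Set (killingAlgebra g)) = generators g ι := by
  refine ⟨nullIdeal hH.toIsNullHypersurface hinv, Set.ext fun K => ?_⟩
  exact (mem_generators_iff hH.toIsHypersurface hinv).symm
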